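/- Let $X$ be a sequentially complete Hausdorff locally convex space over $\mathbb C$, i.e. a Hausdorff topological vector space whose topology is induced by a family of seminorms and in which every Cauchy sequence converges. Let $(T(t))_{t\ge 0}$ be a family of continuous linear operators on $X$ such that - $T(0)=\mathrm{id}$ and $T(t+s)=T(t)T(s)$ for all $t,s\ge 0$ (semigroup); - for every $x\in X$ the map $[0,\infty)\to X$, $t\mapsto T(t)x$, is continuous (strong continuity); - for every continuous seminorm $q$ on $X$ and every $t_0\ge 0$ there are a continuous seminorm $p$ on $X$ and $C\ge 0$ such that $q(T(t)x)\le C\,p(x)$ for all $t\in[0,t_0]$ and $x\in X$ (local equicontinuity). Let $(A,D(A))$ be its generator: $D(A)$ is the set of all $x\in X$ for which $\lim_{t\to 0+}\frac{T(t)x-x}{t}$ exists in $X$, and $Ax$ is this limit for $x\in D(A)$. For $\mu\in\mathbb C$ write $\ker(\mu-A)=\{x\in D(A) : \mu x-Ax=0\}$ and $\ker(\mu-T(t))=\{x\in X : \mu x-T(t)x=0\}$. Then for every $\lambda\in\mathbb C$: (a) $\displaystyle \ker(\lambda-A)=\bigcap_{t\ge 0}\ker\bigl(e^{\lambda t}-T(t)\bigr)$;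 (b) for every $t>0$, $\displaystyle \ker\bigl(e^{\lambda t}-T(t)\bigr)=\overline{\operatorname{span}}\Bigl(\bigcup_{n\in\mathbb Z}\ker\Bigl(\lambda+\frac{2\pi i n}{t}-A\Bigr)\Bigr)$, the closure in $X$ of the linear span. -/

import Mathlib

open Filter Topology
open scoped NNReal

namespace LCSemigroup

/-- Every Cauchy sequence converges. -/
def IsSequentiallyComplete (X : Type*) [UniformSpace X] : Prop :=
  ∀ u : ℕ → X, CauchySeq u → ∃ x, Tendsto u atTop (𝓝 x)

section Semigroup

variable {X : Type*} [AddCommGroup X] [Module ℂ X] [TopologicalSpace X]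

/-- The semigroup law for a family `(T(t))_{t ≥ 0}` of continuous linear operators. -/
structure IsSemigroup (T : ℝ≥0 → X →L[ℂ] X) : Prop where
  map_zero : T 0 = ContinuousLinearMap.id ℂ X
  map_add : ∀ t s : ℝ≥0, T (t + s) = (T t).comp (T s)

/-- Continuity of `t ↦ T(t)` for the topology of pointwise convergence on the space of continuous
linear operators. -/
def IsStronglyContinuous (T : ℝ≥0 → X →L[ℂ] X) : Prop :=
  ∀ x : X, Continuous fun t : ℝ≥0 => T t x

/-- Local equicontinuity, with respect to the fundamental system of all continuous seminorms. -/
def IsLocallyEquicontinuous (T : ℝ≥0 → X →L[ℂ] X) : Prop :=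
  ∀ q : Seminorm ℂ X, Continuous q → ∀ t₀ : ℝ≥0,
    ∃ p : Seminorm ℂ X, Continuous p ∧ ∃ C : ℝ, 0 ≤ C ∧
      ∀ t : ℝ≥0, t ≤ t₀ → ∀ x : X, q (T t x) ≤ C * p x

/-- `y = lim_{t → 0+} (T(t)x - x)/t`. -/
def HasGeneratorLimit (T : ℝ≥0 → X →L[ℂ] X) (x y : X) : Prop :=
  Tendsto (fun t : ℝ≥0 => ((t : ℝ) : ℂ)⁻¹ • (T t x - x)) (𝓝[>] 0) (𝓝 y)

theorem hasGeneratorLimit_zero (T : ℝ≥0 → X →L[ℂ] X) : HasGeneratorLimit T 0 0 := by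
  simpa [HasGeneratorLimit] using tendsto_const_nhds

theorem HasGeneratorLimit.add [IsTopologicalAddGroup X] {T : ℝ≥0 → X →L[ℂ] X} {x x' y y' : X}
    (h : HasGeneratorLimit T x y) (h' : HasGeneratorLimit T x' y') :
    HasGeneratorLimit T (x + x') (y + y') := by
  refine (Tendsto.add h h').congr fun t => ?_
  rw [← smul_add, map_add]
  congr 1
  abel

theorem HasGeneratorLimit.smul [ContinuousSMul ℂ X] {T : ℝ≥0 → X →L[ℂ] X} {x y : X} (c : ℂ)
    (h : HasGeneratorLimit T x y) : HasGeneratorLimit T (c • x) (c • y) := by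
  refine (Tendsto.const_smul h c).congr fun t => ?_
  rw [smul_comm, smul_sub, map_smul]

theorem HasGeneratorLimit.unique [T2Space X] {T : ℝ≥0 → X →L[ℂ] X} {x y y' : X}
    (h : HasGeneratorLimit T x y) (h' : HasGeneratorLimit T x y') : y = y' :=
  tendsto_nhds_unique h h'

/-- The generator `(A, D(A))`: its domain consists of the `x` for which
`lim_{t → 0+} (T(t)x - x)/t` exists in `X`, and `A x` is that limit. -/
noncomputable def generator [IsTopologicalAddGroup X] [ContinuousSMul ℂ X] [T2Space X]
    (T : ℝ≥0 → X →L[ℂ] X) : X →ₗ.[ℂ] X where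
  domain :=
    { carrier := {x | ∃ y, HasGeneratorLimit T x y}
      zero_mem' := ⟨0, hasGeneratorLimit_zero T⟩
      add_mem' := fun ⟨y, hy⟩ ⟨y', hy'⟩ => ⟨y + y', hy.add hy'⟩
      smul_mem' := fun c _ ⟨y, hy⟩ => ⟨c • y, hy.smul c⟩ }
  toFun :=
    { toFun := fun x => x.2.choose
      map_add' := fun x x' =>
        (x + x').2.choose_spec.unique (x.2.choose_spec.add x'.2.choose_spec)
      map_smul' := fun c x =>
        (c • x).2.choose_spec.unique (x.2.choose_spec.smul c) }

end Semigroup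

/-- `ker (μ - A) = {x ∈ D(A) | μ x - A x = 0}`, as a subspace of `X`. -/
def eigenspace {X : Type*} [AddCommGroup X] [Module ℂ X] (A : X →ₗ.[ℂ] X) (μ : ℂ) :
    Submodule ℂ X :=
  (LinearMap.ker (μ • A.domain.subtype - A.toFun)).map A.domain.subtype

end LCSemigroup

/-! By Hahn–Banach, continuous functionals separate points and detect closed subspaces, so
everything reduces to the scalar functions `s ↦ f (T s x)`. For an eigenvector `x`, such a function
has right derivative `μ` times itself, so it is an exponential; this gives (a).

For (b), if `T t x = exp (μ t) • x`, then `s ↦ exp (-μ s) • T s x` is `t`-periodic on `[0, ∞)`. Up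
to the factor `1/t`, its Fourier coefficients are weak integrals over one period, obtained as limits
of Riemann sums by sequential completeness. Applying `T r` shifts the period, so the `n`-th one is
an eigenvector for `μ + 2πin/t`. A functional killing all these eigenvectors yields a continuous
periodic function with zero Fourier coefficients, hence `f x = 0`. The reverse inclusion follows
from (a), since the kernel is closed. -/

open MeasureTheory Set

namespace LCSemigroup

/-! ### Hahn–Banach consequences and weak integrals of curves -/

section WeakIntegral

/-- Left Riemann sums of a continuous function on `[0, 1]` approximate its integral up to the
oscillation of the function on intervals of the length of the mesh. -/
theorem norm_integral_sub_riemannSum_le {g : ℝ → ℂ} (hg : Continuous g) {N : ℕ} (hN : 0 < N)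
    {ε : ℝ} (h : ∀ s ∈ Icc (0 : ℝ) 1, ∀ s' ∈ Icc (0 : ℝ) 1, |s - s'| ≤ (N : ℝ)⁻¹ →
      ‖g s - g s'‖ ≤ ε) :
    ‖(∫ s in (0 : ℝ)..1, g s) - (N : ℂ)⁻¹ * ∑ k ∈ Finset.range N, g (k / N)‖ ≤ ε := by
  have hN' : (0 : ℝ) < N := by exact_mod_cast hN
  have hlen : ∀ k : ℕ, ((k + 1 : ℕ) : ℝ) / N - k / N = (N : ℝ)⁻¹ := fun k => by
    push_cast; field_simp; ring
  have hsum : (∫ s in (0 : ℝ)..1, g s) =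
      ∑ k ∈ Finset.range N, ∫ s in ((k : ℝ) / N)..(((k + 1 : ℕ) : ℝ) / N), g s := by
    rw [intervalIntegral.sum_integral_adjacent_intervals (a := fun k : ℕ => (k : ℝ) / N)
      fun k _ => hg.intervalIntegrable _ _]
    simp [div_self hN'.ne']
  rw [hsum, Finset.mul_sum, ← Finset.sum_sub_distrib]
  have hterm : ∀ k ∈ Finset.range N,
      ‖(∫ s in ((k : ℝ) / N)..(((k + 1 : ℕ) : ℝ) / N), g s) - (N : ℂ)⁻¹ * g (k / N)‖
        ≤ ε * (N : ℝ)⁻¹ := by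
    intro k hk
    have hk1 : ((k + 1 : ℕ) : ℝ) / N ≤ 1 :=
      (div_le_one hN').2 (by exact_mod_cast Finset.mem_range.1 hk)
    have hk0 : (0 : ℝ) ≤ k / N := by positivity
    have hle : (k : ℝ) / N ≤ ((k + 1 : ℕ) : ℝ) / N := by
      have := hlen k
      have := inv_pos.2 hN'
      linarith
    have hconst : (N : ℂ)⁻¹ * g (k / N) =
        ∫ _s in ((k : ℝ) / N)..(((k + 1 : ℕ) : ℝ) / N), g (k / N) := by
      rw [intervalIntegral.integral_const, hlen, Complex.real_smul]
      push_cast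
      rfl
    rw [hconst, ← intervalIntegral.integral_sub (hg.intervalIntegrable _ _)
      (continuous_const.intervalIntegrable _ _)]
    refine (intervalIntegral.norm_integral_le_of_norm_le_const (C := ε) fun s hs => ?_).trans ?_
    · rw [uIoc_of_le hle] at hs
      refine h s ⟨hk0.trans hs.1.le, hs.2.trans hk1⟩ _ ⟨hk0, hle.trans hk1⟩ ?_
      rw [abs_of_nonneg (by linarith [hs.1])]
      linarith [hs.2, hlen k]
    · rw [hlen, abs_of_pos (inv_pos.2 hN')]
  refine (norm_sum_le_of_le _ hterm).trans_eq ?_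
  rw [Finset.sum_const, Finset.card_range, nsmul_eq_mul]
  field_simp

variable {X : Type*} [AddCommGroup X] [Module ℂ X]

/-- In a polynormable space every vector is normed, with respect to a continuous seminorm `p`, by
a continuous functional dominated by `p`. -/
theorem exists_strongDual_eq_seminorm [TopologicalSpace X] [PolynormableSpace ℂ X]
    {p : Seminorm ℂ X} (hp : Continuous p) (x : X) :
    ∃ f : StrongDual ℂ X, f x = p x ∧ ∀ z, ‖f z‖ ≤ p z := by
  by_cases hx : x = 0
  · exact ⟨0, by simp [hx], fun z => by simp⟩
  · obtain ⟨g, hg, hgp⟩ := Module.Dual.exists_continuous_extension_of_le_seminorm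
      (Submodule.span ℂ {x}) ((p x : ℂ) • (LinearEquiv.coord ℂ X x hx).toLinearMap)
      (p := p) hp (by
        intro z
        obtain ⟨c, hc⟩ := Submodule.mem_span_singleton.1 z.2
        have hz : z = c • ⟨x, Submodule.mem_span_singleton_self x⟩ := Subtype.ext hc.symm
        rw [hz, map_smul, LinearMap.smul_apply, LinearEquiv.coe_coe, LinearEquiv.coord_self]
        simp [map_smul_eq_mul, abs_of_nonneg (apply_nonneg p x)])
    refine ⟨g, ?_, hgp⟩
    have := hg ⟨x, Submodule.mem_span_singleton_self x⟩
    simpa [LinearEquiv.coord_self] using this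

theorem locallyConvexSpace [TopologicalSpace X] [PolynormableSpace ℂ X] :
    LocallyConvexSpace ℝ X :=
  (PolynormableSpace.withSeminorms ℂ X).toLocallyConvexSpace

/-- Continuous functionals separate the points of a Hausdorff polynormable space. -/
theorem eq_of_forall_strongDual_eq [TopologicalSpace X] [IsTopologicalAddGroup X]
    [ContinuousSMul ℂ X] [PolynormableSpace ℂ X] [T2Space X] {x y : X}
    (h : ∀ f : StrongDual ℂ X, f x = f y) : x = y := by
  have := locallyConvexSpace (X := X)
  by_contra hxy
  obtain ⟨f, hf⟩ := RCLike.geometric_hahn_banach_point_point (𝕜 := ℂ) hxy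
  rw [h f] at hf
  exact lt_irrefl _ hf

/-- A point annihilated by every continuous functional that vanishes on a subspace lies in the
closure of that subspace. -/
theorem mem_topologicalClosure_of_forall_strongDual [TopologicalSpace X] [IsTopologicalAddGroup X]
    [ContinuousSMul ℂ X] [PolynormableSpace ℂ X] {M : Submodule ℂ X} {x : X}
    (h : ∀ f : StrongDual ℂ X, (∀ y ∈ M, f y = 0) → f x = 0) : x ∈ M.topologicalClosure := by
  have := locallyConvexSpace (X := X)
  by_contra hx
  obtain ⟨f, u, hfu, hux⟩ := RCLike.geometric_hahn_banach_closed_point (𝕜 := ℂ)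
    (s := (M.topologicalClosure : Set X)) ((M.topologicalClosure.restrictScalars ℝ).convex)
    M.isClosed_topologicalClosure hx
  have hu : 0 < u := by simpa using hfu 0 (zero_mem _)
  have hf : ∀ y ∈ M, f y = 0 := by
    intro y hy
    by_contra hne
    -- Rescaling `y` inside `M` makes `f` take the value `u` itself, against the strict bound on
    -- `M`.
    have := hfu (((u : ℂ) / f y) • y) (M.le_topologicalClosure (M.smul_mem _ hy))
    rw [map_smul, smul_eq_mul, div_mul_cancel₀ _ hne] at this
    simp at this
  rw [h f hf] at hux
  simp at hux
  linarith

/-- In a sequentially complete polynormable space a continuous curve has a weak integral over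
`[0, 1]`. -/
theorem exists_weakIntegral_unitInterval [UniformSpace X] [IsUniformAddGroup X]
    [ContinuousSMul ℂ X] [PolynormableSpace ℂ X] (hX : IsSequentiallyComplete X) {u : ℝ → X}
    (hu : Continuous u) :
    ∃ y : X, ∀ f : StrongDual ℂ X, f y = ∫ s in (0 : ℝ)..1, f (u s) := by
  let R : ℕ → X := fun n =>
    ((n + 1 : ℕ) : ℂ)⁻¹ • ∑ k ∈ Finset.range (n + 1), u (k / ((n + 1 : ℕ) : ℝ))
  have hosc : ∀ p : Seminorm ℂ X, Continuous p → ∀ ε > 0, ∃ N : ℕ, ∀ n ≥ N,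
      ∀ s ∈ Icc (0 : ℝ) 1, ∀ s' ∈ Icc (0 : ℝ) 1, |s - s'| ≤ ((n + 1 : ℕ) : ℝ)⁻¹ →
        p (u s - u s') ≤ ε := by
    intro p hp ε hε
    have huc := isCompact_Icc.uniformContinuousOn_of_continuous
      (hu.continuousOn (s := Icc (0 : ℝ) 1))
    have hV : {z : X × X | p (z.2 - z.1) < ε} ∈ uniformity X := by
      rw [uniformity_eq_comap_nhds_zero]
      refine ⟨{z | p z < ε}, ?_, fun _ h => h⟩
      exact (isOpen_lt hp continuous_const).mem_nhds (by simpa using hε)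
    obtain ⟨δ, hδ, h⟩ := Metric.mem_uniformity_dist.1 (mem_inf_principal.1 (huc hV))
    obtain ⟨N, hN⟩ := exists_nat_one_div_lt hδ
    refine ⟨N, fun n hn s hs s' hs' hss => (h (a := s') (b := s) ?_ ⟨hs', hs⟩).le⟩
    rw [dist_comm, Real.dist_eq]
    refine (hss.trans ?_).trans_lt hN
    rw [← one_div]
    push_cast
    exact one_div_le_one_div_of_le (by positivity) (by exact_mod_cast Nat.succ_le_succ hn)
  -- `N` depends on `p` only, not on `f`; the Cauchy argument can therefore pick `f` after `n` and
  -- `m`.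
  have happrox : ∀ p : Seminorm ℂ X, Continuous p → ∀ ε > 0, ∃ N : ℕ, ∀ n ≥ N,
      ∀ f : StrongDual ℂ X, (∀ z, ‖f z‖ ≤ p z) →
        ‖(∫ s in (0 : ℝ)..1, f (u s)) - f (R n)‖ ≤ ε := by
    intro p hp ε hε
    obtain ⟨N, hN⟩ := hosc p hp ε hε
    refine ⟨N, fun n hn f hf => ?_⟩
    have := norm_integral_sub_riemannSum_le (f.continuous.comp hu) (Nat.succ_pos n)
      (ε := ε) fun s hs s' hs' hss => by
        rw [Function.comp_apply, Function.comp_apply, ← map_sub]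
        exact (hf _).trans (hN n hn s hs s' hs' hss)
    simpa [R] using this
  have hcauchy : CauchySeq R := by
    rw [cauchySeq_iff]
    intro V hV
    rw [uniformity_eq_comap_nhds_zero] at hV
    obtain ⟨W, hW, hWV⟩ := hV
    obtain ⟨I, r, hr, hball⟩ := ((PolynormableSpace.withSeminorms ℂ X).mem_nhds_iff 0 W).1 hW
    have hp : Continuous (I.sup (fun p : {p : Seminorm ℂ X // Continuous p} => p.1) : Seminorm ℂ X) :=
      Seminorm.continuous_finsetSup fun i _ => i.2
    obtain ⟨N, hN⟩ := happrox _ hp (r / 3) (by positivity)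
    refine ⟨N, fun n hn m hm => hWV (hball ?_)⟩
    obtain ⟨f, hfx, hf⟩ := exists_strongDual_eq_seminorm hp (R m - R n)
    rw [Seminorm.mem_ball_zero]
    have h1 := hN n hn f hf
    have h2 := hN m hm f hf
    have h3 : ‖f (R m - R n)‖ ≤ r / 3 + r / 3 := by
      rw [map_sub, ← sub_sub_sub_cancel_left _ _ (∫ s in (0 : ℝ)..1, f (u s))]
      exact (norm_sub_le _ _).trans (add_le_add h1 h2)
    rw [hfx, Complex.norm_real, Real.norm_of_nonneg (apply_nonneg _ _)] at h3
    exact h3.trans_lt (by linarith)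
  obtain ⟨y, hy⟩ := hX R hcauchy
  refine ⟨y, fun f => tendsto_nhds_unique ((f.continuous.tendsto y).comp hy) ?_⟩
  rw [Metric.tendsto_atTop]
  intro ε hε
  obtain ⟨N, hN⟩ := happrox f.toSeminorm f.continuous.norm (ε / 2) (by positivity)
  refine ⟨N, fun n hn => ?_⟩
  rw [dist_comm, dist_eq_norm]
  exact (hN n hn f fun _ => le_rfl).trans_lt (by linarith)

/-- In a sequentially complete polynormable space a continuous curve has a weak integral over
`[0, b]`. -/
theorem exists_weakIntegral [UniformSpace X] [IsUniformAddGroup X]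
    [ContinuousSMul ℂ X] [PolynormableSpace ℂ X] (hX : IsSequentiallyComplete X) {u : ℝ → X}
    (hu : Continuous u) (b : ℝ) :
    ∃ y : X, ∀ f : StrongDual ℂ X, f y = ∫ s in (0 : ℝ)..b, f (u s) := by
  obtain ⟨y, hy⟩ := exists_weakIntegral_unitInterval hX
    (hu.comp (continuous_const_mul b))
  refine ⟨(b : ℂ) • y, fun f => ?_⟩
  have := intervalIntegral.smul_integral_comp_mul_left (a := 0) (b := 1) (fun s => f (u s)) b
  simp only [mul_zero, mul_one] at this
  rw [map_smul, hy, ← this, Complex.real_smul, smul_eq_mul]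
  rfl

end WeakIntegral

/-! ### Eigenvectors, exponential orbits and Fourier coefficients -/

section Eigenspace

variable {X : Type*} [AddCommGroup X] [Module ℂ X]

theorem mem_ker_smul_id_sub_iff [TopologicalSpace X] {B : X →L[ℂ] X} {c : ℂ} {x : X} :
    x ∈ LinearMap.ker (c • LinearMap.id - (B : X →ₗ[ℂ] X)) ↔ B x = c • x := by
  simp only [LinearMap.mem_ker, LinearMap.sub_apply, LinearMap.smul_apply, LinearMap.id_apply,
    ContinuousLinearMap.coe_coe, sub_eq_zero]
  exact eq_comm

/-- Limits are unique in a Hausdorff space, so the choice made in `generator` is immaterial. -/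
theorem mem_eigenspace_generator_iff [TopologicalSpace X] [IsTopologicalAddGroup X]
    [ContinuousSMul ℂ X] [T2Space X] {T : ℝ≥0 → X →L[ℂ] X} {μ : ℂ} {x : X} :
    x ∈ eigenspace (generator T) μ ↔ HasGeneratorLimit T x (μ • x) := by
  constructor
  · rintro ⟨z, hz, rfl⟩
    have hz' : μ • (z : X) = z.2.choose := sub_eq_zero.1 hz
    have := z.2.choose_spec
    rwa [← hz'] at this
  · intro h
    refine ⟨⟨x, ⟨_, h⟩⟩, ?_, rfl⟩
    have hx : ∃ y, HasGeneratorLimit T x y := ⟨_, h⟩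
    have : hx.choose = μ • x := hx.choose_spec.unique h
    change μ • x - hx.choose = 0
    rw [this, sub_self]

/-- An orbit of the form `t ↦ exp (μ t) x` starts at an eigenvector of the generator. -/
theorem hasGeneratorLimit_of_forall_eq_exp_smul [TopologicalSpace X]
    [ContinuousSMul ℂ X] {T : ℝ≥0 → X →L[ℂ] X} {μ : ℂ} {x : X}
    (h : ∀ t : ℝ≥0, T t x = Complex.exp (μ * ((t : ℝ) : ℂ)) • x) :
    HasGeneratorLimit T x (μ • x) := by
  have hd : HasDerivAt (fun t : ℝ => Complex.exp (μ * (t : ℂ))) μ 0 := by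
    have h1 : HasDerivAt (fun t : ℝ => μ * (t : ℂ)) μ 0 := by
      simpa using (Complex.ofRealCLM.hasDerivAt (x := (0 : ℝ))).const_mul μ
    simpa using h1.cexp
  have hs := hd.tendsto_slope_zero_right
  have hcoe : Tendsto (fun t : ℝ≥0 => (t : ℝ)) (𝓝[>] 0) (𝓝[>] 0) := by
    refine tendsto_nhdsWithin_iff.2 ⟨?_, ?_⟩
    · exact (NNReal.continuous_coe.tendsto 0).mono_left nhdsWithin_le_nhds
    · filter_upwards [self_mem_nhdsWithin] with t ht
      exact NNReal.coe_pos.2 ht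
  refine ((hs.comp hcoe).smul_const x).congr fun t => ?_
  rw [h t]
  simp only [Function.comp_apply, zero_add, Complex.ofReal_zero, mul_zero, Complex.exp_zero,
    Complex.real_smul, Complex.ofReal_inv]
  rw [mul_smul, sub_smul, one_smul]

theorem continuous_orbit [TopologicalSpace X] {T : ℝ≥0 → X →L[ℂ] X} (hTc : IsStronglyContinuous T)
    (x : X) : Continuous fun s : ℝ => T s.toNNReal x :=
  (hTc x).comp continuous_real_toNNReal

/-- The orbit of an eigenvector of the generator is `t ↦ exp (μ t) x`. -/
theorem eq_exp_smul_of_hasGeneratorLimit [TopologicalSpace X] [IsTopologicalAddGroup X]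
    [ContinuousSMul ℂ X] [PolynormableSpace ℂ X] [T2Space X] {T : ℝ≥0 → X →L[ℂ] X}
    (hT : IsSemigroup T) (hTc : IsStronglyContinuous T) {μ : ℂ} {x : X}
    (h : HasGeneratorLimit T x (μ • x)) (t : ℝ≥0) :
    T t x = Complex.exp (μ * ((t : ℝ) : ℂ)) • x := by
  refine eq_of_forall_strongDual_eq fun f => ?_
  let w : ℝ → ℂ := fun s => f (T s.toNNReal x)
  have hw : Continuous w := f.continuous.comp (continuous_orbit hTc x)
  have hwd : ∀ s : ℝ, 0 ≤ s → HasDerivWithinAt w (μ * w s) (Ici s) s := by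
    intro s hs
    rw [← hasDerivWithinAt_Ioi_iff_Ici, hasDerivWithinAt_iff_tendsto_slope' self_notMem_Ioi]
    have hshift : Tendsto (fun r : ℝ => (r - s).toNNReal) (𝓝[>] s) (𝓝[>] 0) := by
      refine tendsto_nhdsWithin_iff.2 ⟨?_, ?_⟩
      · have : Continuous fun r : ℝ => (r - s).toNNReal := by fun_prop
        exact (this.tendsto' s 0 (by simp)).mono_left nhdsWithin_le_nhds
      · filter_upwards [self_mem_nhdsWithin] with r hr
        exact Real.toNNReal_pos.2 (sub_pos.2 hr)
    -- Factoring `T s` out of the difference quotient at `s` leaves the one at `0`.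
    have hlim := ((f.comp (T s.toNNReal)).continuous.tendsto (μ • x)).comp (h.comp hshift)
    rw [ContinuousLinearMap.map_smul] at hlim
    refine hlim.congr' ?_
    filter_upwards [self_mem_nhdsWithin] with r hr
    have hr' : 0 ≤ r - s := (sub_pos.2 hr).le
    have hadd : r.toNNReal = s.toNNReal + (r - s).toNNReal := by
      rw [← Real.toNNReal_add hs hr', add_sub_cancel]
    simp only [Function.comp_apply, ContinuousLinearMap.comp_apply, map_smul, map_sub, slope_def_module,
      Real.coe_toNNReal _ hr', w, hadd, hT.map_add, smul_eq_mul, Complex.real_smul,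
      Complex.ofReal_inv]
  have hexp : ∀ s : ℝ, HasDerivAt (fun s : ℝ => Complex.exp (-μ * (s : ℂ)))
      (Complex.exp (-μ * (s : ℂ)) * -μ) s := by
    intro s
    have h1 : HasDerivAt (fun t : ℝ => -μ * (t : ℂ)) (-μ) s := by
      simpa using (Complex.ofRealCLM.hasDerivAt (x := s)).const_mul (-μ)
    exact h1.cexp
  -- The generator limit is one-sided, but a continuous function with zero right derivative is still
  -- constant.
  have hconst := constant_of_has_deriv_right_zero
    (f := fun s : ℝ => Complex.exp (-μ * (s : ℂ)) * w s) (a := 0) (b := t)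
    (by fun_prop) (fun s hs => by
      convert! ((hexp s).hasDerivWithinAt (s := Ici s)).mul (hwd s hs.1) using 1
      ring) t ⟨t.coe_nonneg, le_rfl⟩
  simp only [w, Real.toNNReal_coe, Complex.ofReal_zero, mul_zero, Complex.exp_zero, one_mul,
    Real.toNNReal_zero, hT.map_zero, ContinuousLinearMap.id_apply] at hconst
  rw [map_smul, smul_eq_mul, ← hconst, ← mul_assoc, ← Complex.exp_add]
  simp

/-- The eigenspaces of the generator consist of the vectors with exponential orbits. -/
theorem mem_eigenspace_generator_iff_forall [TopologicalSpace X] [IsTopologicalAddGroup X]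
    [ContinuousSMul ℂ X] [PolynormableSpace ℂ X] [T2Space X] {T : ℝ≥0 → X →L[ℂ] X}
    (hT : IsSemigroup T) (hTc : IsStronglyContinuous T) {μ : ℂ} {x : X} :
    x ∈ eigenspace (generator T) μ ↔
      ∀ t : ℝ≥0, T t x = Complex.exp (μ * ((t : ℝ) : ℂ)) • x :=
  mem_eigenspace_generator_iff.trans
    ⟨eq_exp_smul_of_hasGeneratorLimit hT hTc, hasGeneratorLimit_of_forall_eq_exp_smul⟩

/-- The weak integral of `exp (-ν s) T(s) x` over a period of this curve is an eigenvector of the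
generator. -/
theorem exists_mem_eigenspace_eq_integral [UniformSpace X] [IsUniformAddGroup X]
    [ContinuousSMul ℂ X] [PolynormableSpace ℂ X] [T2Space X] (hX : IsSequentiallyComplete X)
    {T : ℝ≥0 → X →L[ℂ] X} (hT : IsSemigroup T) (hTc : IsStronglyContinuous T) {ν : ℂ} {x : X}
    {τ : ℝ≥0} (hx : T τ x = Complex.exp (ν * ((τ : ℝ) : ℂ)) • x) :
    ∃ y ∈ eigenspace (generator T) ν, ∀ f : StrongDual ℂ X,
      f y = ∫ s in (0 : ℝ)..τ, Complex.exp (-ν * (s : ℂ)) * f (T s.toNNReal x) := by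
  have hexp : Continuous fun s : ℝ => Complex.exp (-ν * (s : ℂ)) := by fun_prop
  obtain ⟨y, hy⟩ := exists_weakIntegral hX
    (u := fun s => Complex.exp (-ν * (s : ℂ)) • T s.toNNReal x)
    (hexp.smul (continuous_orbit hTc x)) τ
  simp only [map_smul, smul_eq_mul] at hy
  refine ⟨y, (mem_eigenspace_generator_iff_forall hT hTc).2 fun r => ?_, hy⟩
  refine eq_of_forall_strongDual_eq fun f => ?_
  let w : ℝ → ℂ := fun s => Complex.exp (-ν * (s : ℂ)) * f (T s.toNNReal x)
  have hw : Continuous w := hexp.mul (f.continuous.comp (continuous_orbit hTc x))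
  -- Restricted to `0 ≤ s` because `toNNReal` freezes the orbit at `x` for negative `s`.
  have hper : ∀ s : ℝ, 0 ≤ s → w (s + τ) = w s := by
    intro s hs
    have : (s + τ).toNNReal = s.toNNReal + τ := by
      rw [Real.toNNReal_add hs τ.coe_nonneg, Real.toNNReal_coe]
    simp only [w]
    rw [this, hT.map_add, ContinuousLinearMap.comp_apply, hx, map_smul, map_smul, smul_eq_mul,
      ← mul_assoc, ← Complex.exp_add]
    congr 2
    push_cast
    ring
  have hshift : (∫ s in (0 : ℝ)..τ, w (s + r)) = ∫ s in (0 : ℝ)..τ, w s := by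
    have h1 : (∫ s in (0 : ℝ)..r, w (s + τ)) = ∫ s in (0 : ℝ)..r, w s := by
      refine intervalIntegral.integral_congr fun s hs => hper s ?_
      rw [uIcc_of_le r.coe_nonneg] at hs
      exact hs.1
    rw [intervalIntegral.integral_comp_add_right] at h1 ⊢
    -- The integral over `[0, τ + r]` is split at `r` and at `τ`, then the two splittings are
    -- compared.
    have h2 := intervalIntegral.integral_add_adjacent_intervals
      (hw.intervalIntegrable (μ := volume) (0 : ℝ) r) (hw.intervalIntegrable r (τ + r))
    have h3 := intervalIntegral.integral_add_adjacent_intervals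
      (hw.intervalIntegrable (μ := volume) (0 : ℝ) τ) (hw.intervalIntegrable τ (r + τ))
    rw [zero_add] at h1 ⊢
    rw [h1, add_comm (r : ℝ) τ] at h3
    exact add_left_cancel (h2.trans (h3.symm.trans (add_comm _ _)))
  -- Testing against `f ∘ T r` moves `T r` under the weak integral.
  have hTr := hy (f.comp (T r))
  simp only [ContinuousLinearMap.comp_apply] at hTr
  rw [hTr, map_smul, smul_eq_mul, hy f]
  change _ = _ * ∫ s in (0 : ℝ)..τ, w s
  rw [← hshift, ← intervalIntegral.integral_const_mul]
  refine intervalIntegral.integral_congr fun s hs => ?_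
  rw [uIcc_of_le τ.coe_nonneg] at hs
  have : (s + r).toNNReal = r + s.toNNReal := by
    rw [Real.toNNReal_add hs.1 r.coe_nonneg, Real.toNNReal_coe, add_comm]
  simp only [w]
  rw [this, hT.map_add, ContinuousLinearMap.comp_apply, ← mul_assoc, ← Complex.exp_add]
  congr 2
  push_cast
  ring

/-- A continuous function on `[0, τ]` with equal values at the end points vanishes at `0` if all
its Fourier coefficients vanish. -/
theorem eq_zero_of_forall_fourierIntegral_eq_zero {g : ℝ → ℂ} (hg : Continuous g) {τ : ℝ}
    (hτ : 0 < τ) (hper : g 0 = g τ)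
    (h : ∀ n : ℤ, (∫ s in (0 : ℝ)..τ,
      Complex.exp (-(2 * Real.pi * Complex.I * n / τ) * s) * g s) = 0) :
    g 0 = 0 := by
  have : Fact (0 < τ) := ⟨hτ⟩
  let G : C(AddCircle τ, ℂ) := ⟨AddCircle.liftIco τ 0 g,
    AddCircle.liftIco_zero_continuous hper hg.continuousOn⟩
  have hcoeff : ∀ n, fourierCoeff G n = 0 := by
    intro n
    change fourierCoeff (AddCircle.liftIco τ 0 g) n = 0
    rw [fourierCoeff_liftIco_eq, fourierCoeffOn_eq_integral]
    simp only [zero_add, sub_zero]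
    refine smul_eq_zero_of_right _ ?_
    rw [← h n]
    refine intervalIntegral.integral_congr fun s _ => ?_
    simp only [smul_eq_mul]
    rw [fourier_coe_apply]
    congr 2
    push_cast
    ring
  -- Zero coefficients are summable, so the Fourier series converges pointwise to `G`.
  have hsum := has_pointwise_sum_fourier_series_of_summable (f := G)
    (by simp [funext hcoeff]) ((0 : ℝ) : AddCircle τ)
  simp only [hcoeff, zero_smul] at hsum
  have hG : G ((0 : ℝ) : AddCircle τ) = g 0 :=
    AddCircle.liftIco_coe_apply (by simpa using hτ)
  rw [← hG]
  exact hsum.unique hasSum_zero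

/-- Shifting the exponent `μ` by a multiple of `2πi / t` does not change `exp (μ t)`. -/
theorem exp_add_two_pi_mul_I_div (μ : ℂ) (n : ℤ) {t : ℝ} (ht : t ≠ 0) :
    Complex.exp ((μ + 2 * (Real.pi : ℂ) * Complex.I * (n : ℂ) / (t : ℂ)) * (t : ℂ)) =
      Complex.exp (μ * (t : ℂ)) := by
  have ht' : (t : ℂ) ≠ 0 := by exact_mod_cast ht
  rw [add_mul, div_mul_cancel₀ _ ht', Complex.exp_add,
    show 2 * (Real.pi : ℂ) * Complex.I * n = n * (2 * Real.pi * Complex.I) by ring,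
    Complex.exp_int_mul_two_pi_mul_I, mul_one]

end Eigenspace

end LCSemigroup

theorem mainTheorem6 {X : Type*} [AddCommGroup X] [Module ℂ X] [UniformSpace X]
    [IsUniformAddGroup X] [ContinuousSMul ℂ X] [PolynormableSpace ℂ X] [T2Space X]
    (hX : LCSemigroup.IsSequentiallyComplete X)
    (T : ℝ≥0 → X →L[ℂ] X)
    (hT : LCSemigroup.IsSemigroup T)
    (hTc : LCSemigroup.IsStronglyContinuous T)
    (hTe : LCSemigroup.IsLocallyEquicontinuous T)
    (μ : ℂ) :
    LCSemigroup.eigenspace (LCSemigroup.generator T) μ =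
        ⨅ t : ℝ≥0, LinearMap.ker
          (Complex.exp (μ * ((t : ℝ) : ℂ)) • LinearMap.id - (T t : X →ₗ[ℂ] X)) ∧
      ∀ t : ℝ≥0, 0 < t →
        LinearMap.ker (Complex.exp (μ * ((t : ℝ) : ℂ)) • LinearMap.id - (T t : X →ₗ[ℂ] X)) =
          (Submodule.span ℂ (⋃ n : ℤ,
            (LCSemigroup.eigenspace (LCSemigroup.generator T)
              (μ + 2 * (Real.pi : ℂ) * Complex.I * (n : ℂ) / ((t : ℝ) : ℂ)) : Set X))).topologicalClosure := by
  open LCSemigroup in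
  refine ⟨?_, fun t ht => le_antisymm (fun x hx => ?_) ?_⟩
  · ext x
    rw [Submodule.mem_iInf, mem_eigenspace_generator_iff_forall hT hTc]
    exact forall_congr' fun t => mem_ker_smul_id_sub_iff.symm
  · have htne : (t : ℝ) ≠ 0 := (NNReal.coe_pos.2 ht).ne'
    rw [mem_ker_smul_id_sub_iff] at hx
    refine mem_topologicalClosure_of_forall_strongDual fun f hf => ?_
    have hg : Continuous fun s : ℝ => Complex.exp (-μ * (s : ℂ)) * f (T s.toNNReal x) := by
      exact (by fun_prop : Continuous fun s : ℝ => Complex.exp (-μ * (s : ℂ))).mul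
        (f.continuous.comp (continuous_orbit hTc x))
    have h0 := eq_zero_of_forall_fourierIntegral_eq_zero hg (NNReal.coe_pos.2 ht) (by
        simp only [Real.toNNReal_zero, Real.toNNReal_coe, hT.map_zero, hx, map_smul, smul_eq_mul]
        rw [← mul_assoc, ← Complex.exp_add]
        simp) fun n => by
      obtain ⟨y, hy, hfy⟩ := exists_mem_eigenspace_eq_integral hX hT hTc
        (ν := μ + 2 * (Real.pi : ℂ) * Complex.I * (n : ℂ) / ((t : ℝ) : ℂ)) (x := x) (τ := t)
        (by rw [exp_add_two_pi_mul_I_div μ n htne, hx])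
      -- The exponential of the shifted exponent splits into `exp (-μ s)` and the `n`-th Fourier
      -- character.
      rw [← hf y (Submodule.subset_span (mem_iUnion.2 ⟨n, hy⟩)), hfy f]
      refine intervalIntegral.integral_congr fun s _ => ?_
      rw [← mul_assoc, ← Complex.exp_add]
      congr 2
      ring
    simpa [hT.map_zero] using h0
  · refine Submodule.topologicalClosure_minimal _ (Submodule.span_le.2 ?_) ?_
    · refine iUnion_subset fun n y hy => ?_
      rw [SetLike.mem_coe, mem_ker_smul_id_sub_iff,
        (mem_eigenspace_generator_iff_forall hT hTc).1 hy t,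
        exp_add_two_pi_mul_I_div μ n (NNReal.coe_pos.2 ht).ne']
    · have : Continuous fun y : X => Complex.exp (μ * ((t : ℝ) : ℂ)) • y - T t y := by fun_prop
      exact isClosed_singleton.preimage this
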